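/- Notation. For $a\in\mathbb R$ let $\mathbb C_a^{+}=\{\operatorname{Im}z>a\}$, $\mathbb C_a^{-}=\{\operatorname{Im}z<a\}$, $\mathbb C^\pm=\mathbb C_0^\pm$, $b^{a}_\mu(z)=\frac{z-\mu}{z-\overline\mu-2ia}$, $\rho_a(z,\mu)=|b^a_\mu(z)|$, $b_\mu=b^0_\mu$ and $\rho=\rho_0$. A set $A\subset\mathbb C_a^{\pm}$ satisfies the Carleson condition if $\inf_{\lambda\in A}\prod_{\mu\in A,\mu\ne\lambda}\rho_a(\lambda,\mu)>0$, and is $N$-Carleson in $\mathbb C_a^\pm$ if it is a disjoint union of $N$ (possibly empty) sets satisfying the Carleson condition. Let $N\ge1$ be an integer, $\tau>0$, $1<p<\infty$, and let $\Lambda\subset\mathbb C$ be such that $\Lambda\cap\mathbb C_a^{+}$ and $\Lambda\cap\mathbb C_a^{-}$ are $N$-Carleson in $\mathbb C_a^+$ and $\mathbb C_a^-$, respectively, for every $a\in\mathbb R$. Adapted partitions. Let $\epsilon>0$. Partition $\Lambda\cap\mathbb C^{+}$ and $\Lambda\cap\mathbb C^{-}$ into non-empty blocks $\sigma$ with $|\sigma|\le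 N$ such that (a) in each of the two half-planes the generalized Carleson condition holds: for some $\delta>0$, $\prod_{\lambda\in\Lambda\cap\mathbb C^\pm}\rho(z,\lambda)\ge\delta\inf_{\sigma}\prod_{\lambda\in\sigma}\rho(z,\lambda)$ for all $z\in\mathbb C^\pm$, the infimum being over the blocks in $\mathbb C^\pm$; (b) the supremum over all blocks $\sigma$ of their $\rho$-diameters is less than $\epsilon/2$ and less than $1$. Keep the blocks $\sigma$ that do not meet $\{|\operatorname{Im}z|<\epsilon\}$, and partition the set of the remaining points of $\Lambda$ (including its real points) into non-empty blocks $\sigma'$ with $|\sigma'|\le N$ and $\sup_{\sigma'}\operatorname{diam}(\sigma')<\epsilon/2$ such that, for some $\delta>0$, the mutual distances of the sets $\{z\in\mathbb C:\prod_{\lambda\in\sigma'}|z-\lambda|\le\delta\}$ are bounded below by a positive constant. The kept blocks $\sigma$ and the blocks $\sigma'$ together form a partition $(\tau_n)_n$ of $\Lambda$. Enumerate each $\tau_n=\{\lambda_{n,1},\dots,\lambda_{n,|\tau_n|}\}$ and choose a point $\lambda_{n,0}\in\tau_n$, both arbitrarily. The sequence space. For $v:\tau_n\to\mathbb C$ define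 the divided differences $D^k_n v$, $0\le k<|\tau_n|$, by $D_n^kv=D^k_n v(\lambda_{n,k+1})$, where $D_n^0v(z)=v(z)$ and $D_n^{k}v(z)=\bigl(D_n^{k-1}v(z)-D_n^{k-1}v(\lambda_{n,k})\bigr)/\beta_{\lambda_{n,k}}(z)$, with $\beta_\mu(z)=b_\mu(z)$ if $\tau_n$ is a kept block $\sigma$, and $\beta_\mu(z)=z-\mu$ if $\tau_n$ is a block $\sigma'$. Let $e_n(z)=e^{i\tau z}$ if $\tau_n$ meets $\{\operatorname{Im}z\ge0\}$ and $e_n(z)=e^{-i\tau z}$ otherwise. Let $X^p_{\tau,\epsilon}(\Lambda)$ be the space of all $a:\Lambda\to\mathbb C$ with $$\|a\|^p_{X^p_{\tau,\epsilon}(\Lambda)}=\sum_n\bigl(1+|\operatorname{Im}\lambda_{n,0}|\bigr)\sum_{k=0}^{|\tau_n|-1}\bigl|D_n^{k}\bigl((a\,e_n)|_{\tau_n}\bigr)\bigr|^p<\infty .$$ Let $PW^p_\tau$ be the space of entire functions $f$ of exponential type at most $\tau$ with $\|f\|_p^p=\int_{\mathbb R}|f(x)|^p\,dx<\infty$, and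 let $R_\Lambda f=(f(\lambda))_{\lambda\in\Lambda}$. Proposition. Suppose that for some $\epsilon>0$ and some choice of the adapted partition, of the enumerations and of the points $\lambda_{n,0}$, the operator $R_\Lambda$ is an isomorphism of normed spaces (a bijection that is bounded with bounded inverse) from $PW^p_\tau$ onto $X^p_{\tau,\epsilon}(\Lambda)$. Then $\Lambda$ is relatively dense: there is $r>0$ such that $d(x,\Lambda)=\inf_{\lambda\in\Lambda}|x-\lambda|<r$ for all $x\in\mathbb R$. -/

import Mathlib

noncomputable section

namespace PaleyWiener

/-- The half-plane `Im z > a`. -/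
def upperHP (a : ℝ) : Set ℂ := {z | a < z.im}

/-- The half-plane `Im z < a`. -/
def lowerHP (a : ℝ) : Set ℂ := {z | z.im < a}

/-- The Blaschke factor `b_μ(z) = (z - μ) / (z - conj μ - 2 i a)`; the same formula serves both
half-planes `Im z > a` and `Im z < a`. -/
def blaschke (a : ℝ) (μ z : ℂ) : ℂ :=
  (z - μ) / (z - (starRingEnd ℂ) μ - 2 * Complex.I * (a : ℂ))

/-- The pseudohyperbolic distance. -/
def rho (a : ℝ) (z μ : ℂ) : ℝ := ‖blaschke a μ z‖

/-- `∏_{μ ∈ A} ρ_a(z, μ)`, the modulus at `z` of the Blaschke product with zero set `A`. For `z`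
and `A` in one of the half-planes all factors lie in `[0, 1]`, so that the (possibly infinite)
product is the infimum of its finite partial products. -/
def blaschkeAbs (a : ℝ) (A : Set ℂ) (z : ℂ) : ℝ :=
  ⨅ F : {F : Finset ℂ // (F : Set ℂ) ⊆ A}, ∏ μ ∈ F.1, rho a z μ

/-- The Carleson condition for a set contained in one of the half-planes bounded by `Im z = a`. -/
def IsCarleson (a : ℝ) (A : Set ℂ) : Prop :=
  ∃ δ : ℝ, 0 < δ ∧ ∀ l ∈ A, δ ≤ blaschkeAbs a (A \ {l}) l

/-- `A` is a disjoint union of `N` (possibly empty) sets satisfying the Carleson condition. -/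
def IsNCarleson (N : ℕ) (a : ℝ) (A : Set ℂ) : Prop :=
  ∃ P : Fin N → Set ℂ, Pairwise (fun i j => Disjoint (P i) (P j)) ∧ (⋃ i, P i) = A ∧
    ∀ i, IsCarleson a (P i)

/-- `A ∩ {Im z > a}` and `A ∩ {Im z < a}` are `N`-Carleson, for every real `a`. -/
def IsNCarlesonInEveryHalfPlane (N : ℕ) (A : Set ℂ) : Prop :=
  ∀ a : ℝ, IsNCarleson N a (A ∩ upperHP a) ∧ IsNCarleson N a (A ∩ lowerHP a)

/-- `P` is a partition of `A` into non-empty finite blocks with at most `N` elements. -/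
structure IsBlockPartition (N : ℕ) (P : Set (Finset ℂ)) (A : Set ℂ) : Prop where
  nonempty : ∀ s ∈ P, s.Nonempty
  card_le : ∀ s ∈ P, s.card ≤ N
  disjoint : ∀ s ∈ P, ∀ t ∈ P, s ≠ t → Disjoint s t
  union : (⋃ s ∈ P, (s : Set ℂ)) = A

/-- The generalized Carleson condition `|B(z)| ≥ δ inf_n |B_n(z)|` in the half-plane `U`, bounded
by `Im z = a`, for the Blaschke products `B` of `A` and `B_n` of the blocks of `A`. -/
def GeneralizedCarleson (a : ℝ) (U A : Set ℂ) (P : Set (Finset ℂ)) : Prop :=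
  ∃ δ : ℝ, 0 < δ ∧ ∀ z ∈ U, δ * (⨅ s : P, ∏ μ ∈ s.1, rho a z μ) ≤ blaschkeAbs a A z

/-- The blocks that do not meet the strip `|Im z| < ε`. -/
def farBlocks (ε : ℝ) (P : Set (Finset ℂ)) : Set (Finset ℂ) :=
  {s ∈ P | ∀ z ∈ s, ε ≤ |z.im|}

/-- The set `{z : ∏_{l ∈ s} |z - l| ≤ δ}`. -/
def lemniscate (δ : ℝ) (s : Finset ℂ) : Set ℂ := {z | ∏ l ∈ s, ‖z - l‖ ≤ δ}

/-- A partition of `Λ` adapted to `ε`, together with the choices that enter the norm. The sets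
`Λ ∩ {Im z > 0}` and `Λ ∩ {Im z < 0}` are first split into pseudohyperbolically small blocks
satisfying the generalized Carleson condition. The blocks that avoid the strip `|Im z| < ε` are
kept; what remains of `Λ` is split again into blocks `near` that are small and separated
in the Euclidean sense. -/
structure AdaptedPartition (N : ℕ) (ε : ℝ) (Λ : Set ℂ) where
  /-- blocks in the upper half-plane -/
  upper : Set (Finset ℂ)
  /-- blocks in the lower half-plane -/
  lower : Set (Finset ℂ)
  /-- blocks of the points close to the real axis -/
  near : Set (Finset ℂ)
  upper_partition : IsBlockPartition N upper (Λ ∩ upperHP 0)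
  lower_partition : IsBlockPartition N lower (Λ ∩ lowerHP 0)
  upper_carleson : GeneralizedCarleson 0 (upperHP 0) (Λ ∩ upperHP 0) upper
  lower_carleson : GeneralizedCarleson 0 (lowerHP 0) (Λ ∩ lowerHP 0) lower
  rho_diam : ∃ ρ₀ : ℝ, ρ₀ < ε / 2 ∧ ρ₀ < 1 ∧
    ∀ s ∈ upper ∪ lower, ∀ z ∈ s, ∀ w ∈ s, rho 0 z w ≤ ρ₀
  near_partition :
    IsBlockPartition N near (Λ \ ⋃ s ∈ farBlocks ε (upper ∪ lower), (s : Set ℂ))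
  near_diam : ∃ d : ℝ, d < ε / 2 ∧ ∀ s ∈ near, ∀ z ∈ s, ∀ w ∈ s, dist z w ≤ d
  near_separated : ∃ δ : ℝ, 0 < δ ∧ ∃ η : ℝ, 0 < η ∧ ∀ s ∈ near, ∀ t ∈ near, s ≠ t →
    ∀ z ∈ lemniscate δ s, ∀ w ∈ lemniscate δ t, η ≤ dist z w
  /-- an enumeration of each block -/
  node : ∀ s : Finset ℂ, Fin s.card ≃ s
  /-- a distinguished point of each block -/
  base : Finset ℂ → ℂ
  base_mem : ∀ s ∈ farBlocks ε (upper ∪ lower) ∪ near, base s ∈ s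

/-- Divided differences with respect to `b`, for nodes `μ₀, …, μ_{m-1}` and values
`v₀, …, v_{m-1}`: `dividedDiff b μ v k i` is the `k`-th divided difference of
`v₀, …, v_{k-1}, v_i`. -/
def dividedDiff (b : ℂ → ℂ → ℂ) {m : ℕ} (μ v : Fin m → ℂ) : ℕ → Fin m → ℂ
  | 0, i => v i
  | k + 1, i =>
    if h : k < m then
      (dividedDiff b μ v k i - dividedDiff b μ v k ⟨k, h⟩) / b (μ ⟨k, h⟩) (μ i)
    else 0

open Classical in
/-- The exponential factor on the block `s`: `e^{iτz}` if `s` meets `Im z ≥ 0`, and `e^{-iτz}`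
otherwise. -/
def expFactor (τ : ℝ) (s : Finset ℂ) (z : ℂ) : ℂ :=
  if ∃ w ∈ s, 0 ≤ w.im then Complex.exp (Complex.I * τ * z) else Complex.exp (-Complex.I * τ * z)

open Classical in
/-- The sequence `a`, extended by zero to `ℂ`. -/
def extendZero {Λ : Set ℂ} (a : Λ → ℂ) (z : ℂ) : ℂ := if h : z ∈ Λ then a ⟨z, h⟩ else 0

namespace AdaptedPartition

variable {N : ℕ} {ε : ℝ} {Λ : Set ℂ}

/-- The blocks of the final partition of `Λ`. -/
def blocks (P : AdaptedPartition N ε Λ) : Set (Finset ℂ) :=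
  farBlocks ε (P.upper ∪ P.lower) ∪ P.near

open Classical in
/-- The kernel of the divided differences on a block: Euclidean on the blocks close to the real
axis, pseudohyperbolic on the other ones. -/
def kernel (P : AdaptedPartition N ε Λ) (s : Finset ℂ) : ℂ → ℂ → ℂ :=
  if s ∈ P.near then fun μ z => z - μ else blaschke 0

/-- The `k`-th divided difference of `a e^{±iτ·}` at the first `k + 1` points of the block `s`. -/
def blockDiff (P : AdaptedPartition N ε Λ) (τ : ℝ) (a : Λ → ℂ) (s : Finset ℂ)
    (k : Fin s.card) : ℂ :=
  dividedDiff (P.kernel s) (fun i => (P.node s i : ℂ))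
    (fun i => extendZero a (P.node s i) * expFactor τ s (P.node s i)) k k

/-- The `p`-th power of the norm, as an element of `[0, ∞]`. -/
def normPow (P : AdaptedPartition N ε Λ) (τ p : ℝ) (a : Λ → ℂ) : ENNReal :=
  ∑' s : P.blocks, ENNReal.ofReal
    ((1 + |(P.base s.1).im|) * ∑ k : Fin s.1.card, ‖P.blockDiff τ a s.1 k‖ ^ p)

/-- The sequence space. -/
def X (P : AdaptedPartition N ε Λ) (τ p : ℝ) : Set (Λ → ℂ) :=
  {a | P.normPow τ p a < ⊤}

/-- The norm of the sequence space. -/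
def normX (P : AdaptedPartition N ε Λ) (τ p : ℝ) (a : Λ → ℂ) : ℝ :=
  (P.normPow τ p a).toReal ^ (1 / p)

end AdaptedPartition

/-- The Paley–Wiener space: entire functions of exponential type at most `τ` whose restriction
to the real line is in `L^p`. -/
def PW (τ p : ℝ) : Set (ℂ → ℂ) :=
  {f | Differentiable ℂ f ∧
    (∀ η : ℝ, 0 < η → ∃ C : ℝ, ∀ z : ℂ, ‖f z‖ ≤ C * Real.exp ((τ + η) * ‖z‖)) ∧
    MeasureTheory.Integrable (fun x : ℝ => ‖f (x : ℂ)‖ ^ p)}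

/-- The norm of the Paley–Wiener space. -/
def normPW (p : ℝ) (f : ℂ → ℂ) : ℝ := (∫ x : ℝ, ‖f (x : ℂ)‖ ^ p) ^ (1 / p)

/-- The restriction operator. -/
def restriction (Λ : Set ℂ) (f : ℂ → ℂ) : Λ → ℂ := fun l => f l

/-- The restriction operator (which is linear) is an isomorphism of normed spaces from the
Paley–Wiener space onto the sequence space: a bijection, bounded with bounded inverse. -/
def RestrictionIsIsomorphism {N : ℕ} {ε : ℝ} {Λ : Set ℂ} (P : AdaptedPartition N ε Λ)
    (τ p : ℝ) : Prop :=
  Set.BijOn (restriction Λ) (PW τ p) (P.X τ p) ∧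
    ∃ c C : ℝ, 0 < c ∧ 0 < C ∧ ∀ f ∈ PW τ p,
      c * normPW p f ≤ P.normX τ p (restriction Λ f) ∧
      P.normX τ p (restriction Λ f) ≤ C * normPW p f

/-- `Λ` is relatively dense: the distances `d(x, Λ)`, `x` real, are bounded by some `r`
(the distance to the empty set is infinite). -/
def RelativelyDense (Λ : Set ℂ) : Prop :=
  ∃ r : ℝ, 0 < r ∧ ∀ x : ℝ, Metric.infEDist (x : ℂ) Λ < ENNReal.ofReal r

end PaleyWiener

end

/-!
Compare two families of functions in the Paley–Wiener space that are concentrated near a real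
point `x`: the slowly decaying `g_x(z) = sin (τ (z - x)) / (z - x)` and the quickly decaying
`f_x(z) = (sin (τ (z - x) / 2) / (z - x)) ^ 2`. Suppose that `Λ` has no point within distance `R`
of `x`. On a block at a point `λ`, the maximum principle, applied on a disc of fixed Euclidean or
hyperbolic radius, bounds all divided differences of `f_x e^{± iτz}` by a multiple of
`|λ - x|⁻²`. With `x' = x + π / (2 τ)`, the values of `g_x e^{± iτz}` and `g_{x'} e^{± iτz}` at
`λ` cannot both be small compared with `|λ - x|⁻¹`, because sine and cosine have no common zeros.
Hence the sequence of `f_x` has norm `O(R⁻¹)` relative to those of `g_x` and `g_{x'}`. The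
Paley–Wiener norms of all these functions are independent of `x`, so that `R` is bounded if the
restriction operator is bounded above and below.
-/

namespace PaleyWiener

open Bornology Complex Filter Function Metric Set
open UpperHalfPlane hiding I
open scoped ComplexConjugate

section DividedDifferences

theorem diffContOnCl_dslope {U : Set ℂ} (hU : IsOpen U) {f : ℂ → ℂ} (hf : DiffContOnCl ℂ f U)
    {ν : ℂ} (hν : ν ∈ U) : DiffContOnCl ℂ (dslope f ν) U :=
  ⟨(differentiableOn_dslope (hU.mem_nhds hν)).2 hf.differentiableOn,
    (continuousOn_dslope (mem_of_superset (hU.mem_nhds hν) subset_closure)).2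
      ⟨hf.continuousOn, hf.differentiableAt hU hν⟩⟩

theorem exists_diffContOnCl_eq_sub_div {U : Set ℂ} (hU : IsOpen U) (hUb : IsBounded U)
    {ν : ℂ} (hν : ν ∈ U) {q : ℂ → ℂ} (hq : DiffContOnCl ℂ q U) {c : ℝ} (hc : 0 < c)
    (hfr : ∀ z ∈ frontier U, c ≤ ‖(z - ν) / q z‖) {f : ℂ → ℂ} (hf : DiffContOnCl ℂ f U)
    {M : ℝ} (hM : ∀ z ∈ closure U, ‖f z‖ ≤ M) :
    ∃ g : ℂ → ℂ, DiffContOnCl ℂ g U ∧ (∀ z ∈ closure U, ‖g z‖ ≤ 2 / c * M) ∧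
      ∀ z, z ≠ ν → g z = (f z - f ν) / ((z - ν) / q z) := by
  have hquot : ∀ z, z ≠ ν → dslope f ν z * q z = (f z - f ν) / ((z - ν) / q z) := fun z hz => by
    rw [dslope_of_ne _ hz, slope_def_field, div_div_eq_mul_div, mul_div_right_comm]
  have hg : DiffContOnCl ℂ (fun z => dslope f ν z * q z) U := (diffContOnCl_dslope hU hf hν).smul hq
  refine ⟨_, hg, fun z hz => norm_le_of_forall_mem_frontier_norm_le hUb hg (fun w hw => ?_) hz,
    hquot⟩
  have hwν : w ≠ ν := by
    rintro rfl
    exact hw.2 (hU.interior_eq.symm ▸ hν)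
  have hsub : ‖f w - f ν‖ ≤ 2 * M := by
    linarith [norm_sub_le (f w) (f ν), hM w (frontier_subset_closure hw), hM ν (subset_closure hν)]
  calc ‖dslope f ν w * q w‖ = ‖f w - f ν‖ / ‖(w - ν) / q w‖ := by rw [hquot w hwν, norm_div]
    _ ≤ 2 * M / c := div_le_div₀ ((norm_nonneg _).trans hsub) hsub hc (hfr w hw)
    _ = 2 / c * M := by ring

-- Each difference quotient is again holomorphic in `U`, so that the maximum principle
-- costs one factor `2 / c` per order and never sees the distances between the nodes.
theorem norm_dividedDiff_le {U : Set ℂ} (hU : IsOpen U) (hUb : IsBounded U)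
    {m : ℕ} {μ : Fin m → ℂ} (hμ : Injective μ) (hμU : ∀ i, μ i ∈ U)
    {b q : ℂ → ℂ → ℂ} (hb : ∀ i z, b (μ i) z = (z - μ i) / q (μ i) z)
    (hq : ∀ i, DiffContOnCl ℂ (q (μ i)) U) {c : ℝ} (hc : 0 < c)
    (hfr : ∀ i, ∀ z ∈ frontier U, c ≤ ‖b (μ i) z‖)
    {f : ℂ → ℂ} (hf : DiffContOnCl ℂ f U) {M : ℝ} (hM : ∀ z ∈ closure U, ‖f z‖ ≤ M)
    {k : ℕ} {i : Fin m} (hki : k ≤ i) :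
    ‖dividedDiff b μ (f ∘ μ) k i‖ ≤ (2 / c) ^ k * M := by
  have interpolant : ∀ k : ℕ, k < m → ∃ g : ℂ → ℂ, DiffContOnCl ℂ g U ∧
      (∀ z ∈ closure U, ‖g z‖ ≤ (2 / c) ^ k * M) ∧
      ∀ i : Fin m, k ≤ i → dividedDiff b μ (f ∘ μ) k i = g (μ i) := by
    intro k
    induction k with
    | zero => exact fun _ => ⟨f, hf, by simpa using hM, fun _ _ => rfl⟩
    | succ k ih =>
      intro hk
      have hkm : k < m := by omega
      obtain ⟨g, hg, hgM, hgd⟩ := ih hkm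
      obtain ⟨h, hh, hhM, hhd⟩ := exists_diffContOnCl_eq_sub_div hU hUb (hμU ⟨k, hkm⟩)
        (hq ⟨k, hkm⟩) hc (fun z hz => hb ⟨k, hkm⟩ z ▸ hfr ⟨k, hkm⟩ z hz) hg hgM
      refine ⟨h, hh, fun z hz => (hhM z hz).trans_eq (by ring), fun i hi => ?_⟩
      have hne : μ i ≠ μ ⟨k, hkm⟩ := hμ.ne (Fin.ne_of_val_ne (by simp only; omega))
      rw [hhd _ hne, dividedDiff, dif_pos hkm, hgd i (by omega), hgd ⟨k, hkm⟩ le_rfl, hb]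
  obtain ⟨g, -, hgM, hgd⟩ := interpolant k (by omega)
  rw [hgd i hki]
  exact hgM _ (subset_closure (hμU i))

theorem norm_dividedDiff_sub_le {m : ℕ} {μ : Fin m → ℂ} (hμ : Injective μ) {l : ℂ} {d : ℝ}
    (hμl : ∀ i, dist (μ i) l ≤ d) {f : ℂ → ℂ} (hf : DiffContOnCl ℂ f (ball l (d + 1))) {M : ℝ}
    (hM : ∀ z ∈ closedBall l (d + 1), ‖f z‖ ≤ M) {k : ℕ} {i : Fin m} (hki : k ≤ i) :
    ‖dividedDiff (fun w z => z - w) μ (f ∘ μ) k i‖ ≤ 2 ^ k * M := by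
  have hbound := norm_dividedDiff_le isOpen_ball isBounded_ball hμ
    (fun i => mem_ball.2 ((hμl i).trans_lt (lt_add_one d)))
    (b := fun w z => z - w) (q := fun _ _ => 1) (fun _ _ => (div_one _).symm)
    (fun _ => diffContOnCl_const) one_pos ?_ hf
    (fun z hz => hM z (closure_ball_subset_closedBall hz)) hki
  · rwa [div_one] at hbound
  · intro i z hz
    have hzl : dist z l = d + 1 := frontier_ball_subset_sphere hz
    rw [← dist_eq_norm]
    linarith [dist_triangle z (μ i) l, hμl i]

end DividedDifferences

section PseudohyperbolicDistance

theorem blaschke_zero (μ z : ℂ) : blaschke 0 μ z = (z - μ) / (z - conj μ) := by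
  simp only [blaschke, ofReal_zero, mul_zero, sub_zero]

theorem blaschke_zero_neg (μ z : ℂ) : blaschke 0 (-μ) (-z) = blaschke 0 μ z := by
  rw [blaschke_zero, blaschke_zero, map_neg, ← neg_div_neg_eq]
  ring_nf

theorem tanh_pos {x : ℝ} (hx : 0 < x) : 0 < Real.tanh x := by
  rw [Real.tanh_eq_sinh_div_cosh]
  exact div_pos (Real.sinh_pos_iff.2 hx) (Real.cosh_pos x)

theorem monotone_tanh : Monotone Real.tanh := fun x y hxy => by
  rwa [← Real.artanh_le_artanh_iff (Real.tanh_bijOn.mapsTo trivial)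
    (Real.tanh_bijOn.mapsTo trivial), Real.artanh_tanh, Real.artanh_tanh]

theorem rho_zero_coe (z w : ℍ) : rho 0 z w = Real.tanh (dist z w / 2) := by
  rw [tanh_half_dist, rho, blaschke_zero, norm_div, dist_eq_norm, dist_eq_norm]

theorem dist_le_of_rho_le {z w : ℍ} {r : ℝ} (hr : r < 1) (h : rho 0 z w ≤ r) :
    dist z w ≤ 2 * Real.artanh r := by
  have hrho : -1 < rho 0 z w := neg_one_lt_zero.trans_le (norm_nonneg _)
  have hartanh := Real.artanh_le_artanh hrho hr h
  rw [rho_zero_coe, Real.artanh_tanh] at hartanh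
  linarith

theorem abs_im_le_of_rho_le {z w : ℂ} {r : ℝ} (hr : r < 1) (h : rho 0 z w ≤ r) :
    |z.im| ≤ (1 + r) / (1 - r) * |w.im| := by
  have hr0 : 0 ≤ r := (norm_nonneg _).trans h
  have hr1 : 0 < 1 - r := sub_pos.2 hr
  have hz : |z.im| ≤ |w.im| + ‖z - w‖ := by
    linarith [abs_sub_abs_le_abs_sub z.im w.im, sub_im z w ▸ abs_im_le_norm (z - w)]
  rw [div_mul_eq_mul_div, le_div_iff₀ hr1]
  rcases eq_or_ne z (conj w) with rfl | hne
  · rw [conj_im, abs_neg]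
    nlinarith [abs_nonneg w.im]
  · rw [rho, blaschke_zero, norm_div, div_le_iff₀ (norm_pos_iff.2 (sub_ne_zero.2 hne))] at h
    have hconj : ‖z - conj w‖ ≤ ‖z - w‖ + 2 * |w.im| := by
      calc ‖z - conj w‖ ≤ ‖z - w‖ + ‖w - conj w‖ := norm_sub_le_norm_sub_add_norm_sub _ _ _
        _ = ‖z - w‖ + 2 * |w.im| := by rw [sub_conj]; simp
    nlinarith

theorem norm_sub_ofReal_le_exp_dist_mul (z w : ℍ) (x : ℝ) :
    ‖(z : ℂ) - x‖ ≤ Real.exp (dist z w) * ‖(w : ℂ) - x‖ := by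
  have him : w.im ≤ ‖(w : ℂ) - x‖ := by
    simpa using (le_abs_self _).trans (abs_im_le_norm ((w : ℂ) - x))
  have hexp : 1 ≤ Real.exp (dist z w) := Real.one_le_exp dist_nonneg
  calc ‖(z : ℂ) - x‖ ≤ dist (z : ℂ) w + ‖(w : ℂ) - x‖ := by
        rw [dist_eq_norm]; exact norm_sub_le_norm_sub_add_norm_sub _ _ _
    _ ≤ w.im * (Real.exp (dist z w) - 1) + ‖(w : ℂ) - x‖ := by gcongr; exact dist_coe_le z w
    _ ≤ ‖(w : ℂ) - x‖ * (Real.exp (dist z w) - 1) + ‖(w : ℂ) - x‖ := by gcongr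
    _ = Real.exp (dist z w) * ‖(w : ℂ) - x‖ := by ring

theorem norm_dividedDiff_blaschke_le {m : ℕ} {μ : Fin m → ℍ} (hμ : Injective μ) {l : ℍ} {d : ℝ}
    (hμl : ∀ i, dist (μ i) l ≤ d) {f : ℂ → ℂ} (hf : DifferentiableOn ℂ f (upperHP 0)) {M : ℝ}
    (hM : ∀ z : ℍ, dist z l ≤ d + 1 → ‖f z‖ ≤ M) {k : ℕ} {i : Fin m} (hki : k ≤ i) :
    ‖dividedDiff (blaschke 0) (fun i => (μ i : ℂ)) (fun i => f (μ i)) k i‖ ≤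
      (2 / Real.tanh (1 / 2)) ^ k * M := by
  set V := ball (l.center (d + 1) : ℂ) (l.im * Real.sinh (d + 1))
  have hV : (↑) '' ball l (d + 1) = V := image_coe_ball l (d + 1)
  have hcl : closure V ⊆ (↑) '' closedBall l (d + 1) := by
    rw [image_coe_closedBall]
    exact closure_ball_subset_closedBall
  refine norm_dividedDiff_le (U := V) (q := fun w z => z - conj w) isOpen_ball isBounded_ball
    (UpperHalfPlane.coe_injective.comp hμ) (fun i => ?_) (fun _ _ => blaschke_zero _ _)
    (fun i => (differentiable_id.sub_const _).diffContOnCl)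
    (tanh_pos one_half_pos) (fun i z hz => ?_)
    (hf.mono ?_).diffContOnCl (fun z hz => ?_) hki
  · exact hV.subset (mem_image_of_mem _ (mem_ball.2 ((hμl i).trans_lt (lt_add_one d))))
  · obtain ⟨w, hw, rfl⟩ := image_coe_sphere l (d + 1) ▸ frontier_ball_subset_sphere hz
    have hdist : 1 ≤ dist w (μ i) := by
      linarith [dist_triangle w (μ i) l, hμl i, mem_sphere.1 hw]
    rw [← rho, comp_apply, rho_zero_coe]
    exact monotone_tanh (by linarith)
  · intro z hz
    obtain ⟨w, -, rfl⟩ := hcl hz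
    exact w.im_pos
  · obtain ⟨w, hw, rfl⟩ := hcl hz
    exact hM w hw

theorem dividedDiff_blaschke_zero_neg {m : ℕ} (μ v : Fin m → ℂ) (k : ℕ) (i : Fin m) :
    dividedDiff (blaschke 0) (-μ) v k i = dividedDiff (blaschke 0) μ v k i := by
  induction k generalizing i with
  | zero => rfl
  | succ k ih => simp only [dividedDiff, ih, Pi.neg_apply, blaschke_zero_neg]

end PseudohyperbolicDistance

section QuadraticDecay

theorem le_div_sq_of_mul_sq_le {t u v A E : ℝ} (ht : 0 ≤ t) (hu : 0 < u) (huv : u ≤ A * v)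
    (hE : t * v ^ 2 ≤ E) : t ≤ A ^ 2 * E / u ^ 2 := by
  rw [le_div_iff₀ (pow_pos hu 2)]
  calc t * u ^ 2 ≤ t * (A * v) ^ 2 := by gcongr
    _ = A ^ 2 * (t * v ^ 2) := by ring
    _ ≤ A ^ 2 * E := by gcongr

theorem norm_dividedDiff_sub_mul_sq_le {m : ℕ} {μ : Fin m → ℂ} (hμ : Injective μ) {l : ℂ} {d : ℝ}
    (hμl : ∀ i, dist (μ i) l ≤ d) {x : ℂ} (hlx : 2 * (d + 1) ≤ ‖l - x‖) {f : ℂ → ℂ}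
    (hf : DiffContOnCl ℂ f (ball l (d + 1))) {E : ℝ}
    (hE : ∀ z ∈ closedBall l (d + 1), ‖f z‖ * ‖z - x‖ ^ 2 ≤ E) {k : ℕ} {i : Fin m} (hki : k ≤ i) :
    ‖dividedDiff (fun w z => z - w) μ (f ∘ μ) k i‖ * ‖l - x‖ ^ 2 ≤ 2 ^ k * (2 ^ 2 * E) := by
  have hlx0 : 0 < ‖l - x‖ := by linarith [dist_nonneg.trans (hμl i)]
  have hM : ∀ z ∈ closedBall l (d + 1), ‖f z‖ ≤ 2 ^ 2 * E / ‖l - x‖ ^ 2 := fun z hz => by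
    refine le_div_sq_of_mul_sq_le (norm_nonneg _) hlx0 ?_ (hE z hz)
    have hzl : ‖l - z‖ ≤ d + 1 := by rwa [← dist_eq_norm, dist_comm]
    linarith [norm_sub_le_norm_sub_add_norm_sub l z x]
  have hbound := norm_dividedDiff_sub_le hμ hμl hf hM hki
  rwa [mul_div_assoc', le_div_iff₀ (pow_pos hlx0 2)] at hbound

theorem norm_dividedDiff_blaschke_mul_sq_le_of_im_pos {m : ℕ} {μ : Fin m → ℂ} (hμ : Injective μ)
    (hμ0 : ∀ i, 0 < (μ i).im) {l : ℂ} (hl : 0 < l.im) {r : ℝ} (hr : r < 1)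
    (hμl : ∀ i, rho 0 (μ i) l ≤ r) {f : ℂ → ℂ} (hf : DifferentiableOn ℂ f (upperHP 0)) {x : ℝ}
    (hfx : ∀ z : ℂ, 0 < z.im → ‖f z‖ * ‖z - x‖ ^ 2 ≤ 1) {k : ℕ} {i : Fin m} (hki : k ≤ i) :
    ‖dividedDiff (blaschke 0) μ (f ∘ μ) k i‖ * ‖l - x‖ ^ 2 ≤
      (2 / Real.tanh (1 / 2)) ^ k * Real.exp (2 * Real.artanh r + 1) ^ 2 := by
  lift l to ℍ using hl
  lift μ to Fin m → ℍ using hμ0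
  have hlx : 0 < ‖(l : ℂ) - x‖ := norm_pos_iff.2 (sub_ne_zero.2 (l.ne_ofReal x))
  have hM : ∀ z : ℍ, dist z l ≤ 2 * Real.artanh r + 1 →
      ‖f z‖ ≤ Real.exp (2 * Real.artanh r + 1) ^ 2 * 1 / ‖(l : ℂ) - x‖ ^ 2 := fun z hz => by
    refine le_div_sq_of_mul_sq_le (norm_nonneg _) hlx ?_ (hfx z z.im_pos)
    refine (norm_sub_ofReal_le_exp_dist_mul l z x).trans ?_
    gcongr
    rwa [dist_comm]
  have hbound := norm_dividedDiff_blaschke_le (fun i j hij => hμ (congrArg _ hij))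
    (fun i => dist_le_of_rho_le hr (hμl i)) hf hM hki
  rwa [mul_div_assoc', le_div_iff₀ (pow_pos hlx 2), mul_one] at hbound

theorem norm_dividedDiff_blaschke_mul_sq_le_of_im_neg {m : ℕ} {μ : Fin m → ℂ} (hμ : Injective μ)
    (hμ0 : ∀ i, (μ i).im < 0) {l : ℂ} (hl : l.im < 0) {r : ℝ} (hr : r < 1)
    (hμl : ∀ i, rho 0 (μ i) l ≤ r) {f : ℂ → ℂ} (hf : DifferentiableOn ℂ f (lowerHP 0)) {x : ℝ}
    (hfx : ∀ z : ℂ, z.im < 0 → ‖f z‖ * ‖z - x‖ ^ 2 ≤ 1) {k : ℕ} {i : Fin m} (hki : k ≤ i) :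
    ‖dividedDiff (blaschke 0) μ (f ∘ μ) k i‖ * ‖l - x‖ ^ 2 ≤
      (2 / Real.tanh (1 / 2)) ^ k * Real.exp (2 * Real.artanh r + 1) ^ 2 := by
  have hnorm : ∀ z : ℂ, ‖-z - (-x : ℝ)‖ = ‖z - x‖ := fun z => by
    rw [ofReal_neg, neg_sub_neg, norm_sub_rev]
  have hbound := norm_dividedDiff_blaschke_mul_sq_le_of_im_pos (μ := -μ) (l := -l)
    (f := fun z => f (-z)) (x := -x) (neg_injective.comp hμ) (fun i => neg_pos.2 (hμ0 i))
    (neg_pos.2 hl) hr (fun i => ?_) ?_ (fun z hz => ?_) hki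
  · rw [dividedDiff_blaschke_zero_neg, hnorm] at hbound
    simpa only [comp_def, Pi.neg_apply, neg_neg] using hbound
  · rw [rho, Pi.neg_apply, blaschke_zero_neg]
    exact hμl i
  · exact hf.comp differentiable_neg.differentiableOn fun z (hz : 0 < z.im) => neg_lt_zero.2 hz
  · have h := hfx (-z) (neg_lt_zero.2 hz)
    rwa [← hnorm, neg_neg] at h

end QuadraticDecay

section SincScaled

theorem norm_exp_I_mul (τ : ℝ) (z : ℂ) : ‖exp (I * τ * z)‖ = Real.exp (-(τ * z.im)) := by
  simp [norm_exp]

theorem norm_exp_neg_I_mul (τ : ℝ) (z : ℂ) : ‖exp (-I * τ * z)‖ = Real.exp (τ * z.im) := by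
  simp [norm_exp]

theorem norm_expFactor_of_im_nonneg (τ : ℝ) {s : Finset ℂ} {w : ℂ} (hw : w ∈ s) (hw0 : 0 ≤ w.im)
    (z : ℂ) : ‖expFactor τ s z‖ = Real.exp (-(τ * z.im)) := by
  rw [expFactor, if_pos ⟨w, hw, hw0⟩, norm_exp_I_mul]

theorem norm_expFactor_of_im_neg (τ : ℝ) {s : Finset ℂ} (hs : ∀ w ∈ s, w.im < 0) (z : ℂ) :
    ‖expFactor τ s z‖ = Real.exp (τ * z.im) := by
  rw [expFactor, if_neg fun ⟨w, hw, hw0⟩ => (hs w hw).not_ge hw0, norm_exp_neg_I_mul]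

theorem norm_expFactor_mem_Icc {τ : ℝ} (hτ : 0 ≤ τ) (s : Finset ℂ) (z : ℂ) :
    ‖expFactor τ s z‖ ∈ Icc (Real.exp (-(τ * |z.im|))) (Real.exp (τ * |z.im|)) := by
  have hz : |τ * z.im| ≤ τ * |z.im| := by rw [abs_mul, abs_of_nonneg hτ]
  rw [abs_le] at hz
  unfold expFactor
  split_ifs
  · rw [norm_exp_I_mul]
    exact ⟨Real.exp_le_exp.2 (by linarith), Real.exp_le_exp.2 (by linarith)⟩
  · rw [norm_exp_neg_I_mul]
    exact ⟨Real.exp_le_exp.2 hz.1, Real.exp_le_exp.2 hz.2⟩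

theorem differentiable_expFactor (τ : ℝ) (s : Finset ℂ) : Differentiable ℂ (expFactor τ s) := by
  unfold expFactor
  split_ifs <;> fun_prop

theorem norm_sin_le_exp_abs_im (w : ℂ) : ‖sin w‖ ≤ Real.exp |w.im| := by
  have hneg : ‖exp (-w * I)‖ ≤ Real.exp |w.im| := by simpa [norm_exp] using le_abs_self w.im
  have hpos : ‖exp (w * I)‖ ≤ Real.exp |w.im| := by simpa [norm_exp] using neg_le_abs w.im
  rw [sin, norm_div, norm_mul, norm_I, mul_one, norm_ofNat]
  linarith [norm_sub_le (exp (-w * I)) (exp (w * I))]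

theorem norm_exp_mul_I_le_norm_sin_add_norm_cos (w : ℂ) :
    ‖exp (w * I)‖ ≤ ‖sin w‖ + ‖cos w‖ := by
  rw [exp_mul_I, add_comm ‖sin w‖]
  exact (norm_add_le _ _).trans_eq (by rw [norm_mul, norm_I, mul_one])

theorem exp_abs_im_le_norm_sin_add_norm_cos (w : ℂ) :
    Real.exp |w.im| ≤ ‖sin w‖ + ‖cos w‖ := by
  rcases abs_cases w.im with ⟨h, -⟩ | ⟨h, -⟩ <;> rw [h]
  · simpa [norm_exp] using norm_exp_mul_I_le_norm_sin_add_norm_cos (-w)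
  · simpa [norm_exp] using norm_exp_mul_I_le_norm_sin_add_norm_cos w

/-- The entire function `sin (a z) / z`, with its value `a` at `0`: the building block of the
test functions in the Paley–Wiener space. -/
noncomputable def sincScaled (a : ℝ) : ℂ → ℂ := dslope (fun z => sin (a * z)) 0

theorem differentiable_sincScaled (a : ℝ) : Differentiable ℂ (sincScaled a) := by
  rw [← differentiableOn_univ, sincScaled, differentiableOn_dslope univ_mem]
  fun_prop

theorem sincScaled_zero (a : ℝ) : sincScaled a 0 = a := by
  have hderiv : HasDerivAt (fun z : ℂ => sin (a * z)) (cos (a * 0) * (a * 1)) 0 :=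
    ((hasDerivAt_id (0 : ℂ)).const_mul (a : ℂ)).csin
  rw [sincScaled, dslope_same, hderiv.deriv, mul_zero, cos_zero, one_mul, mul_one]

theorem sincScaled_mul_self (a : ℝ) (w : ℂ) : sincScaled a w * w = sin (a * w) := by
  simpa [sincScaled, mul_comm] using sub_smul_dslope (fun z : ℂ => sin (a * z)) 0 w

theorem norm_sincScaled_mul_le {a : ℝ} (ha : 0 ≤ a) (w : ℂ) :
    ‖sincScaled a w‖ * ‖w‖ ≤ Real.exp (a * |w.im|) := by
  rw [← norm_mul, sincScaled_mul_self]
  simpa [abs_mul, abs_of_nonneg ha] using norm_sin_le_exp_abs_im (a * w)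

theorem exists_norm_sincScaled_le {a : ℝ} (ha : 0 ≤ a) :
    ∃ C, 0 ≤ C ∧ ∀ w, ‖sincScaled a w‖ * (1 + ‖w‖) ≤ C * Real.exp (a * |w.im|) := by
  obtain ⟨C, hC⟩ := (isCompact_closedBall (0 : ℂ) 1).exists_bound_of_continuousOn
    (differentiable_sincScaled a).continuous.continuousOn
  have hC0 : 0 ≤ C := (norm_nonneg _).trans (hC 0 (by simp))
  refine ⟨2 * C + 2, by positivity, fun w => ?_⟩
  have hexp : 1 ≤ Real.exp (a * |w.im|) := Real.one_le_exp (by positivity)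
  rcases le_total ‖w‖ 1 with hw | hw
  · have hCw := hC w (by simpa using hw)
    nlinarith [norm_nonneg (sincScaled a w), norm_nonneg w]
  · nlinarith [norm_nonneg (sincScaled a w), norm_sincScaled_mul_le ha w]

theorem norm_sin_mul_sub_add_pi_div {τ : ℝ} (hτ : τ ≠ 0) (x : ℝ) (l : ℂ) :
    ‖sin (τ * (l - (x + Real.pi / (2 * τ) : ℝ)))‖ = ‖cos (τ * (l - x))‖ := by
  have hτ' : (τ : ℂ) ≠ 0 := ofReal_ne_zero.2 hτ
  have hshift : (τ : ℂ) * (l - (x + Real.pi / (2 * τ) : ℝ)) = τ * (l - x) - Real.pi / 2 := by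
    push_cast
    field_simp
    ring
  rw [hshift, sin_sub_pi_div_two, norm_neg]

-- The shift by `π / (2 τ)` turns the sine into a cosine, and the two have no common zeros.
theorem exp_abs_im_le_norm_sincScaled_add {τ : ℝ} (hτ : 0 < τ) {x : ℝ} {l : ℂ}
    (hl : Real.pi / (2 * τ) ≤ ‖l - x‖) :
    Real.exp (τ * |l.im|) ≤ 2 * ‖l - x‖ *
      (‖sincScaled τ (l - x)‖ + ‖sincScaled τ (l - (x + Real.pi / (2 * τ) : ℝ))‖) := by
  set x' : ℝ := x + Real.pi / (2 * τ)
  have him : |((τ : ℂ) * (l - x)).im| = τ * |l.im| := by simp [abs_mul, abs_of_pos hτ]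
  have hxx' : ‖(x : ℂ) - x'‖ = Real.pi / (2 * τ) := by
    rw [← ofReal_sub, norm_real, sub_add_cancel_left, norm_neg, Real.norm_of_nonneg (by positivity)]
  have hlx' : ‖l - x'‖ ≤ 2 * ‖l - x‖ := by
    linarith [norm_sub_le_norm_sub_add_norm_sub l x x']
  calc Real.exp (τ * |l.im|)
      ≤ ‖sin (τ * (l - x))‖ + ‖sin (τ * (l - x'))‖ := by
        rw [← him, norm_sin_mul_sub_add_pi_div hτ.ne']
        exact exp_abs_im_le_norm_sin_add_norm_cos _
    _ = ‖sincScaled τ (l - x)‖ * ‖l - x‖ + ‖sincScaled τ (l - x')‖ * ‖l - x'‖ := by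
        rw [← sincScaled_mul_self, ← sincScaled_mul_self, norm_mul, norm_mul]
    _ ≤ ‖sincScaled τ (l - x)‖ * (2 * ‖l - x‖) + ‖sincScaled τ (l - x')‖ * (2 * ‖l - x‖) := by
        gcongr
        linarith [norm_nonneg (l - x)]
    _ = _ := by ring

end SincScaled

section PaleyWienerSpace

variable {τ p : ℝ} {f : ℂ → ℂ}

theorem mem_PW_of_norm_le (hτ : 0 ≤ τ) (hp : 1 < p) (hf : Differentiable ℂ f) {C : ℝ}
    (hC : 0 ≤ C) (hfC : ∀ w, ‖f w‖ * (1 + ‖w‖) ≤ C * Real.exp (τ * |w.im|)) : f ∈ PW τ p := by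
  refine ⟨hf, fun η hη => ⟨C, fun z => ?_⟩, ?_⟩
  · calc ‖f z‖ ≤ ‖f z‖ * (1 + ‖z‖) := le_mul_of_one_le_right (norm_nonneg _) (by simp)
      _ ≤ C * Real.exp (τ * |z.im|) := hfC z
      _ ≤ C * Real.exp ((τ + η) * ‖z‖) := by
        gcongr
        · linarith
        · exact abs_im_le_norm z
  · have hint : MeasureTheory.Integrable fun x : ℝ => C ^ p * (1 + ‖x‖) ^ (-p) :=
      (integrable_one_add_norm (by simpa using hp)).const_mul _
    refine hint.mono' ?_ (.of_forall fun x => ?_)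
    · exact ((hf.continuous.comp continuous_ofReal).norm.rpow_const
        fun _ => Or.inr (by linarith)).aestronglyMeasurable
    · have hx : 0 < 1 + ‖x‖ := by positivity
      have hfx : ‖f x‖ ≤ C / (1 + ‖x‖) := (le_div_iff₀ hx).2 (by simpa using hfC x)
      rw [Real.norm_of_nonneg (by positivity), Real.rpow_neg hx.le, ← div_eq_mul_inv,
        ← Real.div_rpow hC hx.le]
      gcongr

theorem comp_sub_mem_PW (hτ : 0 ≤ τ) (hf : f ∈ PW τ p) (x : ℝ) :
    (fun z => f (z - x)) ∈ PW τ p := by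
  obtain ⟨hdiff, htype, hint⟩ := hf
  refine ⟨hdiff.comp (differentiable_id.sub_const _), fun η hη => ?_,
    by simpa using hint.comp_sub_right x⟩
  obtain ⟨C, hC⟩ := htype η hη
  have hC0 : 0 ≤ C := by simpa using (norm_nonneg _).trans (hC 0)
  refine ⟨C * Real.exp ((τ + η) * ‖(x : ℂ)‖), fun z => (hC _).trans ?_⟩
  rw [mul_assoc, ← Real.exp_add, ← mul_add, add_comm ‖(x : ℂ)‖]
  gcongr
  exact norm_sub_le _ _

theorem normPW_comp_sub (p : ℝ) (f : ℂ → ℂ) (x : ℝ) :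
    normPW p (fun z => f (z - x)) = normPW p f := by
  simpa [normPW] using congrArg (· ^ (1 / p))
    (MeasureTheory.integral_sub_right_eq_self (fun t : ℝ => ‖f (t : ℂ)‖ ^ p) x)

theorem normPW_pos (hp : 0 < p) (hf : f ∈ PW τ p) {x : ℝ} (hx : f x ≠ 0) : 0 < normPW p f := by
  have hcont : Continuous fun t : ℝ => ‖f t‖ ^ p :=
    (hf.1.continuous.comp continuous_ofReal).norm.rpow_const fun _ => Or.inr hp.le
  exact Real.rpow_pos_of_pos (MeasureTheory.integral_pos_of_integrable_nonneg_nonzero (x := x) hcont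
    hf.2.2 (fun _ => by positivity) (Real.rpow_pos_of_pos (norm_pos_iff.2 hx) _).ne') _

theorem sincScaled_mem_PW (hτ : 0 ≤ τ) (hp : 1 < p) : sincScaled τ ∈ PW τ p := by
  obtain ⟨C, hC, hbound⟩ := exists_norm_sincScaled_le hτ
  exact mem_PW_of_norm_le hτ hp (differentiable_sincScaled τ) hC hbound

theorem exp_half_mul_sq (τ t : ℝ) : Real.exp (τ / 2 * t) ^ 2 = Real.exp (τ * t) := by
  rw [← Real.exp_nat_mul]
  ring_nf

theorem sincScaled_half_sq_mem_PW (hτ : 0 ≤ τ) (hp : 1 < p) :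
    (fun z => sincScaled (τ / 2) z ^ 2) ∈ PW τ p := by
  obtain ⟨C, -, hbound⟩ := exists_norm_sincScaled_le (div_nonneg hτ zero_le_two)
  refine mem_PW_of_norm_le (C := C ^ 2) hτ hp ((differentiable_sincScaled _).pow 2) (by positivity)
    fun w => ?_
  calc ‖sincScaled (τ / 2) w ^ 2‖ * (1 + ‖w‖)
      ≤ ‖sincScaled (τ / 2) w‖ ^ 2 * (1 + ‖w‖) ^ 2 := by
        rw [norm_pow]
        gcongr
        exact le_self_pow₀ (by simp) two_ne_zero
    _ = (‖sincScaled (τ / 2) w‖ * (1 + ‖w‖)) ^ 2 := (mul_pow _ _ _).symm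
    _ ≤ (C * Real.exp (τ / 2 * |w.im|)) ^ 2 := pow_le_pow_left₀ (by positivity) (hbound w) 2
    _ = C ^ 2 * Real.exp (τ * |w.im|) := by rw [mul_pow, exp_half_mul_sq]

/-- An entire function of exponential type that decays quadratically away from the real point `x`.
The bound is normalized so that multiplication by `e^{± iτz}` cancels the exponential growth in one
of the half-planes. -/
structure HasQuadraticDecay (τ x : ℝ) (f : ℂ → ℂ) : Prop where
  differentiable : Differentiable ℂ f
  norm_mul_sq_le : ∀ z : ℂ, ‖f z‖ * ‖z - x‖ ^ 2 ≤ Real.exp (τ * |z.im|)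

theorem HasQuadraticDecay.norm_mul_mul_sq_le {x : ℝ} (hf : HasQuadraticDecay τ x f)
    (z e : ℂ) : ‖f z * e‖ * ‖z - x‖ ^ 2 ≤ Real.exp (τ * |z.im|) * ‖e‖ := by
  rw [norm_mul, mul_right_comm]
  gcongr
  exact hf.norm_mul_sq_le z

theorem hasQuadraticDecay_sincScaled_half_sq (hτ : 0 ≤ τ) (x : ℝ) :
    HasQuadraticDecay τ x fun z => sincScaled (τ / 2) (z - x) ^ 2 where
  differentiable := ((differentiable_sincScaled _).comp (differentiable_id.sub_const _)).pow 2
  norm_mul_sq_le z := by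
    rw [norm_pow, ← mul_pow, ← exp_half_mul_sq]
    gcongr
    simpa using norm_sincScaled_mul_le (div_nonneg hτ zero_le_two) (z - x)

end PaleyWienerSpace

theorem sum_rpow_le_card_mul {ι : Type*} [Fintype ι] {p : ℝ} (hp : 1 ≤ p) {u v w : ι → ℝ}
    (hu : ∀ k, 0 ≤ u k) (hv : ∀ k, 0 ≤ v k) (hw : ∀ k, 0 ≤ w k) {B : ℝ} (hB : 0 ≤ B) {j : ι}
    (h : ∀ k, w k ≤ B * (u j + v j)) :
    ∑ k, w k ^ p ≤ Fintype.card ι * (2 ^ (p - 1) * B ^ p) * (∑ k, u k ^ p + ∑ k, v k ^ p) := by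
  have hconv : (u j + v j) ^ p ≤ 2 ^ (p - 1) * (u j ^ p + v j ^ p) := by
    exact_mod_cast NNReal.rpow_add_le_mul_rpow_add_rpow ⟨u j, hu j⟩ ⟨v j, hv j⟩ hp
  have hle : ∀ a : ι → ℝ, (∀ k, 0 ≤ a k) → a j ^ p ≤ ∑ k, a k ^ p := fun a ha =>
    Finset.single_le_sum (f := fun k => a k ^ p) (fun k _ => Real.rpow_nonneg (ha k) p)
      (Finset.mem_univ j)
  have hterm : ∀ k, w k ^ p ≤ 2 ^ (p - 1) * B ^ p * (∑ k, u k ^ p + ∑ k, v k ^ p) := fun k =>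
    calc w k ^ p ≤ (B * (u j + v j)) ^ p :=
          Real.rpow_le_rpow (hw k) (h k) (zero_le_one.trans hp)
      _ = B ^ p * (u j + v j) ^ p := Real.mul_rpow hB (add_nonneg (hu j) (hv j))
      _ ≤ B ^ p * (2 ^ (p - 1) * (u j ^ p + v j ^ p)) := by gcongr
      _ = 2 ^ (p - 1) * B ^ p * (u j ^ p + v j ^ p) := by ring
      _ ≤ _ := by gcongr; exacts [hle u hu, hle v hv]
  calc ∑ k, w k ^ p ≤ ∑ _ : ι, 2 ^ (p - 1) * B ^ p * (∑ k, u k ^ p + ∑ k, v k ^ p) :=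
        Finset.sum_le_sum fun k _ => hterm k
    _ = _ := by rw [Finset.sum_const, Finset.card_univ, nsmul_eq_mul]; ring

namespace AdaptedPartition

variable {N : ℕ} {ε τ p : ℝ} {Λ : Set ℂ} (P : AdaptedPartition N ε Λ) {s : Finset ℂ}

section Blocks

theorem nonempty_of_mem_blocks (hs : s ∈ P.blocks) : s.Nonempty := by
  rcases hs with ⟨h | h, -⟩ | h
  exacts [P.upper_partition.nonempty s h, P.lower_partition.nonempty s h,
    P.near_partition.nonempty s h]

theorem card_le_of_mem_blocks (hs : s ∈ P.blocks) : s.card ≤ N := by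
  rcases hs with ⟨h | h, -⟩ | h
  exacts [P.upper_partition.card_le s h, P.lower_partition.card_le s h,
    P.near_partition.card_le s h]

theorem mem_of_mem_blocks (hs : s ∈ P.blocks) {z : ℂ} (hz : z ∈ s) : z ∈ Λ := by
  rcases hs with ⟨h | h, -⟩ | h
  exacts [(P.upper_partition.union.subset (mem_biUnion h hz)).1,
    (P.lower_partition.union.subset (mem_biUnion h hz)).1,
    (P.near_partition.union.subset (mem_biUnion h hz)).1]

theorem im_pos_of_mem_upper (hs : s ∈ P.upper) {z : ℂ} (hz : z ∈ s) : 0 < z.im :=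
  (P.upper_partition.union.subset (mem_biUnion hs hz)).2

theorem im_neg_of_mem_lower (hs : s ∈ P.lower) {z : ℂ} (hz : z ∈ s) : z.im < 0 :=
  (P.lower_partition.union.subset (mem_biUnion hs hz)).2

theorem exists_mem_upper_union_lower {z : ℂ} (hz : z ∈ Λ) (hz0 : z.im ≠ 0) :
    ∃ t ∈ P.upper ∪ P.lower, z ∈ t := by
  rcases hz0.lt_or_gt with h | h
  · obtain ⟨t, ht, hzt⟩ := mem_iUnion₂.1 (P.lower_partition.union.superset ⟨hz, h⟩)
    exact ⟨t, .inr ht, hzt⟩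
  · obtain ⟨t, ht, hzt⟩ := mem_iUnion₂.1 (P.upper_partition.union.superset ⟨hz, h⟩)
    exact ⟨t, .inl ht, hzt⟩

-- A point of a block in `P.near` is real or pseudohyperbolically close to some `w` with
-- `|Im w| < ε`.
theorem exists_abs_im_le_of_mem_near : ∃ H : ℝ, ∀ s ∈ P.near, ∀ z ∈ s, |z.im| ≤ H := by
  obtain ⟨r, -, hr1, hr⟩ := P.rho_diam
  refine ⟨max 0 ((1 + r) / (1 - r) * ε), fun s hs z hz => ?_⟩
  obtain ⟨hzΛ, hzfar⟩ := P.near_partition.union.subset (mem_biUnion hs hz)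
  by_cases hz0 : z.im = 0
  · rw [hz0, abs_zero]
    exact le_max_left _ _
  obtain ⟨t, ht, hzt⟩ := P.exists_mem_upper_union_lower hzΛ hz0
  obtain ⟨w, hw, hwε⟩ : ∃ w ∈ t, |w.im| < ε := by
    by_contra! hfar
    exact hzfar (mem_biUnion (show t ∈ farBlocks ε (P.upper ∪ P.lower) from ⟨ht, hfar⟩) hzt)
  have hzw := hr t ht z hzt w hw
  have hr0 : 0 ≤ r := (norm_nonneg _).trans hzw
  calc |z.im| ≤ (1 + r) / (1 - r) * |w.im| := abs_im_le_of_rho_le hr1 hzw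
    _ ≤ (1 + r) / (1 - r) * ε := by gcongr
    _ ≤ _ := le_max_right _ _

end Blocks

section BlockDiff

theorem injective_node (s : Finset ℂ) : Injective fun i => (P.node s i : ℂ) :=
  Subtype.val_injective.comp (P.node s).injective

theorem blockDiff_restriction (τ : ℝ) (f : ℂ → ℂ) (hs : s ∈ P.blocks) (k : Fin s.card) :
    P.blockDiff τ (restriction Λ f) s k = dividedDiff (P.kernel s) (fun i => (P.node s i : ℂ))
      ((fun z => f z * expFactor τ s z) ∘ fun i => (P.node s i : ℂ)) k k := by
  rw [blockDiff]
  congr 1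
  funext i
  rw [extendZero, dif_pos (P.mem_of_mem_blocks hs (P.node s i).2)]
  rfl

theorem blockDiff_restriction_zero (τ : ℝ) (f : ℂ → ℂ) (hs : s ∈ P.blocks) (h0 : 0 < s.card) :
    P.blockDiff τ (restriction Λ f) s ⟨0, h0⟩ =
      f (P.node s ⟨0, h0⟩) * expFactor τ s (P.node s ⟨0, h0⟩) := by
  rw [P.blockDiff_restriction τ f hs]
  rfl

theorem exists_norm_blockDiff_mul_sq_le_of_mem_near (hτ : 0 ≤ τ) :
    ∃ K R₀ : ℝ, ∀ (x : ℝ) (f : ℂ → ℂ), HasQuadraticDecay τ x f →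
      ∀ s ∈ P.near, ∀ l ∈ s, R₀ ≤ ‖l - x‖ → ∀ k,
        ‖P.blockDiff τ (restriction Λ f) s k‖ * ‖l - x‖ ^ 2 ≤ K := by
  obtain ⟨H, hH⟩ := P.exists_abs_im_le_of_mem_near
  obtain ⟨d, -, hd⟩ := P.near_diam
  set E := Real.exp (τ * (H + (d + 1))) * Real.exp (τ * (H + (d + 1)))
  refine ⟨2 ^ N * (2 ^ 2 * E), 2 * (d + 1), fun x f hf s hs l hl hlx k => ?_⟩
  have hs' : s ∈ P.blocks := .inr hs
  have hE : ∀ z ∈ closedBall l (d + 1), ‖f z * expFactor τ s z‖ * ‖z - x‖ ^ 2 ≤ E := by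
    intro z hz
    have hzl : |(z - l).im| ≤ d + 1 := (abs_im_le_norm _).trans (mem_closedBall_iff_norm.1 hz)
    have him : |z.im| ≤ H + (d + 1) := by
      rw [sub_im] at hzl
      linarith [abs_sub_abs_le_abs_sub z.im l.im, hH s hs l hl]
    calc ‖f z * expFactor τ s z‖ * ‖z - x‖ ^ 2
        ≤ Real.exp (τ * |z.im|) * ‖expFactor τ s z‖ := hf.norm_mul_mul_sq_le z _
      _ ≤ Real.exp (τ * |z.im|) * Real.exp (τ * |z.im|) := by
        gcongr
        exact (norm_expFactor_mem_Icc hτ s z).2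
      _ ≤ E := mul_le_mul (Real.exp_le_exp.2 (by gcongr)) (Real.exp_le_exp.2 (by gcongr))
        (Real.exp_pos _).le (Real.exp_pos _).le
  have hF := hf.differentiable.mul (differentiable_expFactor τ s)
  rw [P.blockDiff_restriction τ f hs', kernel, if_pos hs]
  calc _ ≤ 2 ^ (k : ℕ) * (2 ^ 2 * E) :=
        norm_dividedDiff_sub_mul_sq_le (P.injective_node s) (fun i => hd s hs _ (P.node s i).2 l hl)
          hlx hF.diffContOnCl hE le_rfl
    _ ≤ 2 ^ N * (2 ^ 2 * E) := by
        gcongr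
        exacts [one_le_two, k.2.le.trans (P.card_le_of_mem_blocks hs')]

theorem exists_norm_blockDiff_mul_sq_le_of_notMem_near (τ : ℝ) :
    ∃ K : ℝ, ∀ (x : ℝ) (f : ℂ → ℂ), HasQuadraticDecay τ x f →
      ∀ s ∈ P.blocks, s ∉ P.near → ∀ l ∈ s, ∀ k,
        ‖P.blockDiff τ (restriction Λ f) s k‖ * ‖l - x‖ ^ 2 ≤ K := by
  obtain ⟨r, -, hr1, hr⟩ := P.rho_diam
  refine ⟨(2 / Real.tanh (1 / 2)) ^ N * Real.exp (2 * Real.artanh r + 1) ^ 2,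
    fun x f hf s hs hnear l hl k => ?_⟩
  have hbase : 1 ≤ 2 / Real.tanh (1 / 2) := by
    rw [one_le_div (tanh_pos one_half_pos)]
    linarith [Real.tanh_lt_one (1 / 2)]
  have hpow : (2 / Real.tanh (1 / 2)) ^ (k : ℕ) * Real.exp (2 * Real.artanh r + 1) ^ 2 ≤
      (2 / Real.tanh (1 / 2)) ^ N * Real.exp (2 * Real.artanh r + 1) ^ 2 := by
    gcongr
    exact k.2.le.trans (P.card_le_of_mem_blocks hs)
  have hside : s ∈ P.upper ∪ P.lower := (hs.resolve_right hnear).1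
  have hrl : ∀ i, rho 0 (P.node s i) l ≤ r := fun i => hr s hside _ (P.node s i).2 l hl
  have hF := hf.differentiable.mul (differentiable_expFactor τ s)
  rw [P.blockDiff_restriction τ f hs, kernel, if_neg hnear]
  refine le_trans ?_ hpow
  rcases hside with hup | hlow
  · have hpos : ∀ z ∈ s, 0 < z.im := fun z hz => P.im_pos_of_mem_upper hup hz
    refine norm_dividedDiff_blaschke_mul_sq_le_of_im_pos (P.injective_node s)
      (fun i => hpos _ (P.node s i).2) (hpos l hl) hr1 hrl hF.differentiableOn
      (fun z hz => (hf.norm_mul_mul_sq_le z _).trans_eq ?_) le_rfl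
    rw [norm_expFactor_of_im_nonneg τ hl (hpos l hl).le, abs_of_pos hz, ← Real.exp_add,
      add_neg_cancel, Real.exp_zero]
  · have hneg : ∀ z ∈ s, z.im < 0 := fun z hz => P.im_neg_of_mem_lower hlow hz
    refine norm_dividedDiff_blaschke_mul_sq_le_of_im_neg (P.injective_node s)
      (fun i => hneg _ (P.node s i).2) (hneg l hl) hr1 hrl hF.differentiableOn
      (fun z hz => (hf.norm_mul_mul_sq_le z _).trans_eq ?_) le_rfl
    rw [norm_expFactor_of_im_neg τ hneg, abs_of_neg hz, ← Real.exp_add, mul_neg, neg_add_cancel,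
      Real.exp_zero]

theorem exists_norm_blockDiff_mul_sq_le (hτ : 0 ≤ τ) :
    ∃ K R₀ : ℝ, 0 ≤ K ∧ ∀ (x : ℝ) (f : ℂ → ℂ), HasQuadraticDecay τ x f →
      ∀ s ∈ P.blocks, ∀ l ∈ s, R₀ ≤ ‖l - x‖ → ∀ k,
        ‖P.blockDiff τ (restriction Λ f) s k‖ * ‖l - x‖ ^ 2 ≤ K := by
  obtain ⟨K₁, R₀, hnear⟩ := P.exists_norm_blockDiff_mul_sq_le_of_mem_near hτ
  obtain ⟨K₂, hfar⟩ := P.exists_norm_blockDiff_mul_sq_le_of_notMem_near τ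
  refine ⟨max 0 (max K₁ K₂), R₀, le_max_left _ _, fun x f hf s hs l hl hlx k => ?_⟩
  by_cases hsn : s ∈ P.near
  · exact (hnear x f hf s hsn l hl hlx k).trans (by simp)
  · exact (hfar x f hf s hs hsn l hl k).trans (by simp)

theorem one_le_norm_blockDiff_sincScaled_add (hτ : 0 < τ) (x : ℝ) (hs : s ∈ P.blocks)
    (h0 : 0 < s.card) (hl : Real.pi / (2 * τ) ≤ ‖(P.node s ⟨0, h0⟩ : ℂ) - x‖) :
    1 ≤ 2 * ‖(P.node s ⟨0, h0⟩ : ℂ) - x‖ *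
      (‖P.blockDiff τ (restriction Λ fun z => sincScaled τ (z - x)) s ⟨0, h0⟩‖ +
        ‖P.blockDiff τ (restriction Λ fun z =>
          sincScaled τ (z - (x + Real.pi / (2 * τ) : ℝ))) s ⟨0, h0⟩‖) := by
  set l : ℂ := (P.node s ⟨0, h0⟩ : ℂ)
  calc 1 = Real.exp (τ * |l.im|) * Real.exp (-(τ * |l.im|)) := by
        rw [← Real.exp_add, add_neg_cancel, Real.exp_zero]
    _ ≤ 2 * ‖l - x‖ * (‖sincScaled τ (l - x)‖ +
          ‖sincScaled τ (l - (x + Real.pi / (2 * τ) : ℝ))‖) * ‖expFactor τ s l‖ := by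
        gcongr
        exacts [exp_abs_im_le_norm_sincScaled_add hτ hl, (norm_expFactor_mem_Icc hτ.le s l).1]
    _ = _ := by
        rw [P.blockDiff_restriction_zero τ _ hs, P.blockDiff_restriction_zero τ _ hs, norm_mul,
          norm_mul]
        ring

theorem exists_norm_blockDiff_le_div_mul_sincScaled (hτ : 0 < τ) :
    ∃ K : ℝ, 0 ≤ K ∧ ∀ᶠ R in atTop, ∀ (x : ℝ), (∀ l ∈ Λ, R ≤ ‖l - x‖) →
      ∀ f, HasQuadraticDecay τ x f → ∀ s ∈ P.blocks, ∃ j, ∀ k,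
        ‖P.blockDiff τ (restriction Λ f) s k‖ ≤ K / R *
          (‖P.blockDiff τ (restriction Λ fun z => sincScaled τ (z - x)) s j‖ +
            ‖P.blockDiff τ (restriction Λ fun z =>
              sincScaled τ (z - (x + Real.pi / (2 * τ) : ℝ))) s j‖) := by
  obtain ⟨K, R₀, hK, hquad⟩ := P.exists_norm_blockDiff_mul_sq_le hτ.le
  refine ⟨2 * K, by positivity, ?_⟩
  filter_upwards [eventually_ge_atTop R₀, eventually_ge_atTop (Real.pi / (2 * τ)),
    eventually_gt_atTop 0] with R hR₀ hRπ hR x hfar f hf s hs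
  have h0 : 0 < s.card := (P.nonempty_of_mem_blocks hs).card_pos
  have hnode := (P.node s ⟨0, h0⟩).2
  have hlR := hfar _ (P.mem_of_mem_blocks hs hnode)
  refine ⟨⟨0, h0⟩, fun k => ?_⟩
  have hone := P.one_le_norm_blockDiff_sincScaled_add hτ x hs h0 (hRπ.trans hlR)
  have hk := hquad x f hf s hs _ hnode (hR₀.trans hlR) k
  set S := ‖P.blockDiff τ (restriction Λ fun z => sincScaled τ (z - x)) s ⟨0, h0⟩‖ + _
  set D := ‖P.blockDiff τ (restriction Λ f) s k‖
  set t := ‖(P.node s ⟨0, h0⟩ : ℂ) - x‖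
  have ht : 0 < t := hR.trans_le hlR
  calc D ≤ K / t ^ 2 := (le_div_iff₀ (by positivity)).2 hk
    _ ≤ K / t ^ 2 * (2 * t * S) := le_mul_of_one_le_right (by positivity) hone
    _ = 2 * K / t * S := by field_simp
    _ ≤ 2 * K / R * S := by gcongr

end BlockDiff

section Norm

theorem normPow_le_mul_add (hp : 1 ≤ p) {a b c : Λ → ℂ} {B : ℝ} (hB : 0 ≤ B)
    (h : ∀ s ∈ P.blocks, ∃ j, ∀ k,
      ‖P.blockDiff τ a s k‖ ≤ B * (‖P.blockDiff τ b s j‖ + ‖P.blockDiff τ c s j‖)) :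
    P.normPow τ p a ≤
      ENNReal.ofReal (N * (2 ^ (p - 1) * B ^ p)) * (P.normPow τ p b + P.normPow τ p c) := by
  rw [normPow, normPow, normPow, ← ENNReal.tsum_add, ← ENNReal.tsum_mul_left]
  refine ENNReal.tsum_le_tsum fun ⟨s, hs⟩ => ?_
  rw [← ENNReal.ofReal_add (by positivity) (by positivity), ← ENNReal.ofReal_mul (by positivity),
    ← mul_add, mul_left_comm]
  gcongr
  obtain ⟨j, hj⟩ := h s hs
  refine (sum_rpow_le_card_mul hp (fun _ => norm_nonneg _) (fun _ => norm_nonneg _)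
    (fun _ => norm_nonneg _) hB hj).trans ?_
  rw [Fintype.card_fin]
  gcongr
  exact P.card_le_of_mem_blocks hs

theorem normX_nonneg (a : Λ → ℂ) : 0 ≤ P.normX τ p a :=
  Real.rpow_nonneg ENNReal.toReal_nonneg _

theorem normX_rpow (hp : p ≠ 0) (a : Λ → ℂ) : P.normX τ p a ^ p = (P.normPow τ p a).toReal := by
  rw [normX, one_div, Real.rpow_inv_rpow ENNReal.toReal_nonneg hp]

theorem normX_rpow_le_mul_add (hp : 1 ≤ p) {a b c : Λ → ℂ} (hb : b ∈ P.X τ p) (hc : c ∈ P.X τ p)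
    {B : ℝ} (hB : 0 ≤ B)
    (h : ∀ s ∈ P.blocks, ∃ j, ∀ k,
      ‖P.blockDiff τ a s k‖ ≤ B * (‖P.blockDiff τ b s j‖ + ‖P.blockDiff τ c s j‖)) :
    P.normX τ p a ^ p ≤ N * (2 ^ (p - 1) * B ^ p) * (P.normX τ p b ^ p + P.normX τ p c ^ p) := by
  have hp0 : p ≠ 0 := (zero_lt_one.trans_le hp).ne'
  have hsum : P.normPow τ p b + P.normPow τ p c ≠ ⊤ := (ENNReal.add_lt_top.2 ⟨hb, hc⟩).ne
  rw [P.normX_rpow hp0, P.normX_rpow hp0, P.normX_rpow hp0, ← ENNReal.toReal_add hb.ne hc.ne,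
    ← ENNReal.toReal_ofReal (by positivity : 0 ≤ N * (2 ^ (p - 1) * B ^ p)), ← ENNReal.toReal_mul]
  exact ENNReal.toReal_mono (ENNReal.mul_ne_top ENNReal.ofReal_ne_top hsum)
    (P.normPow_le_mul_add hp hB h)

end Norm

end AdaptedPartition

theorem relativelyDense_of_forall_exists_norm_sub_lt {Λ : Set ℂ} {R : ℝ} (hR : 0 < R)
    (h : ∀ x : ℝ, ∃ l ∈ Λ, ‖l - x‖ < R) : RelativelyDense Λ := by
  refine ⟨R, hR, fun x => ?_⟩
  obtain ⟨l, hl, hlx⟩ := h x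
  rw [infEDist_lt_iff]
  refine ⟨l, hl, ?_⟩
  rwa [edist_dist, ENNReal.ofReal_lt_ofReal_iff hR, dist_comm, dist_eq_norm]

end PaleyWiener

open Filter PaleyWiener in
theorem proposition4_general {N : ℕ} {ε τ p : ℝ} (hτ : 0 < τ) (hp : 1 < p) {Λ : Set ℂ}
    (P : AdaptedPartition N ε Λ) (hmaps : Set.MapsTo (restriction Λ) (PW τ p) (P.X τ p))
    {c C : ℝ} (hc : 0 < c)
    (hlower : ∀ f ∈ PW τ p, c * normPW p f ≤ P.normX τ p (restriction Λ f))
    (hupper : ∀ f ∈ PW τ p, P.normX τ p (restriction Λ f) ≤ C * normPW p f) :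
    RelativelyDense Λ := by
  set f : ℂ → ℂ := fun z => sincScaled (τ / 2) z ^ 2
  set g : ℂ → ℂ := sincScaled τ
  have hp0 : 0 < p := zero_lt_one.trans hp
  have hf : f ∈ PW τ p := sincScaled_half_sq_mem_PW hτ.le hp
  have hg (t : ℝ) : (fun z => g (z - t)) ∈ PW τ p :=
    comp_sub_mem_PW hτ.le (sincScaled_mem_PW hτ.le hp) t
  have hf0 : f (0 : ℝ) ≠ 0 := by simp [f, sincScaled_zero, hτ.ne']
  have hgX (t : ℝ) : P.normX τ p (restriction Λ fun z => g (z - t)) ^ p ≤ (C * normPW p g) ^ p :=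
    Real.rpow_le_rpow (P.normX_nonneg _) (normPW_comp_sub p g t ▸ hupper _ (hg t)) hp0.le
  have hcf : 0 < c * normPW p f := mul_pos hc (normPW_pos hp0 hf hf0)
  obtain ⟨K, hK, hcomp⟩ := P.exists_norm_blockDiff_le_div_mul_sincScaled hτ
  have hlim : Tendsto (fun R => N * (2 ^ (p - 1) * (K / R) ^ p) *
      ((C * normPW p g) ^ p + (C * normPW p g) ^ p)) atTop (nhds 0) := by
    simpa [hp0.ne'] using (((tendsto_id.const_div_atTop K).rpow_const (.inr hp0.le)).const_mul
      _).const_mul _ |>.mul_const _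
  obtain ⟨R, hRcomp, hRsmall, hR⟩ := (hcomp.and ((hlim.eventually_lt_const
    (Real.rpow_pos_of_pos hcf p)).and (eventually_gt_atTop 0))).exists
  refine relativelyDense_of_forall_exists_norm_sub_lt hR fun x => ?_
  by_contra! hfar
  refine hRsmall.not_ge ?_
  calc (c * normPW p f) ^ p ≤ P.normX τ p (restriction Λ fun z => f (z - x)) ^ p :=
        Real.rpow_le_rpow hcf.le
          (normPW_comp_sub p f x ▸ hlower _ (comp_sub_mem_PW hτ.le hf x)) hp0.le
    _ ≤ _ := P.normX_rpow_le_mul_add hp.le (hmaps (hg _)) (hmaps (hg _)) (by positivity)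
        (hRcomp x hfar _ (hasQuadraticDecay_sincScaled_half_sq hτ.le x))
    _ ≤ _ := mul_le_mul_of_nonneg_left (add_le_add (hgX _) (hgX _)) (by positivity)

theorem proposition4 (N : ℕ) (hN : 1 ≤ N) (τ p : ℝ) (hτ : 0 < τ) (hp : 1 < p) (Λ : Set ℂ)
    (hΛ : PaleyWiener.IsNCarlesonInEveryHalfPlane N Λ)
    (hiso : ∃ ε : ℝ, 0 < ε ∧ ∃ P : PaleyWiener.AdaptedPartition N ε Λ,
      PaleyWiener.RestrictionIsIsomorphism P τ p) :
    PaleyWiener.RelativelyDense Λ := by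
  obtain ⟨ε, -, P, hbij, c, C, hc, -, hnorm⟩ := hiso
  exact proposition4_general hτ hp P hbij.mapsTo hc (fun f hf => (hnorm f hf).1)
    fun f hf => (hnorm f hf).2
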